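/- **Corollary (Discrete Presentation Theorem for Metric AECs).** *Conventions.* Let $\mathbb{Q}'=\mathbb{Q}\cap[0,1]$. A continuous language $\tau$ consists of finitary function symbols $F$ and relation symbols $R$, together with a symbol $d$ for the metric. A (continuous) $\tau$-structure is a nonempty complete metric space $(M,d)$ with $d\le 1$, with a continuous function $F^M:M^n\to M$ for every $n$-ary function symbol $F$ and a continuous function $R^M:M^n\to[0,1]$ for every $n$-ary relation symbol $R$; uniform continuity is not required. We write $M\subseteq_\tau N$ for substructures (with restricted metric, functions and relations), and $dc$ for density character. A metric abstract elementary class (MAEC) is a class $K$ of $\tau(K)$-structures, with a relation $\prec_K$, such that: 1. $\prec_K$ is a partial order on $K$; 2. if $M\prec_K N$, then $M\subseteq_{\tau(K)}N$; 3. $K$ and $\prec_K$ are closed under $\tau(K)$-isomorphisms; 4. if $M_0\prec_K M_2$, $M_1\prec_K M_2$ and $M_0\subseteq_{\tau(K)} M_1$, then $M_0\prec_K M_1$; 5. if $\langle M_i:i<\alpha\rangle$, $\alpha>0$, is a $\prec_K$-increasing chain in $K$ with $M_\delta=\overline{\bigcup_{i<\delta}M_i}$ at limits $\delta<\alpha$,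 then the completion $\overline{\bigcup_{i<\alpha}M_i}$ exists as a $\tau(K)$-structure, lies in $K$, and satisfies $M_i\prec_K\overline{\bigcup_{i<\alpha}M_i}$ for all $i<\alpha$; if moreover $N\in K$ and $M_i\prec_K N$ for all $i<\alpha$, then $\overline{\bigcup_{i<\alpha}M_i}\prec_K N$; 6. there is an infinite cardinal $\lambda\ge|\tau(K)|$ such that for all $M\in K$ and $A\subseteq M$ there is $N\prec_K M$ with $A\subseteq N$ and $dc(N)\le|A|+\lambda$. The least such $\lambda$ is denoted $LS(K)$. For a continuous language $\tau$, let $\tau^+$ be the discrete (classical first-order) language consisting of the function symbols of $\tau$ and, for each $n$-ary $P\in\{d\}\cup\{R: R \text{ a relation symbol of }\tau\}$ and each $r\in\mathbb{Q}'$, two $n$-ary relation symbols $R_{P\ge r}$ and $R_{P\le r}$. For a nonempty $\tau^+$-structure $A$ put $$P^A(\mathbf a)=\sup\{r\in\mathbb{Q}': A\models R_{P\ge r}[\mathbf a]\},\qquad D=d^A .$$ We say that a $\tau$-structure $M$ is the completion of $A$ with respect to $D$ if * for all $P$, $\mathbf a\in A$ and $r\in\mathbb{Q}'$: $A\models R_{P\ge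 r}[\mathbf a]\iff P^A(\mathbf a)\ge r$, and $A\models R_{P\le r}[\mathbf a]\iff P^A(\mathbf a)\le r$; and * up to an injective identification, $A$ is a dense subset of $M$, closed under the functions of $M$, such that the functions of $M$ restrict to those of $A$, and $P^M(\mathbf a)=P^A(\mathbf a)$ for all $P$ and all $\mathbf a\in A$ (in particular $d^M$ extends $D$). Such an $M$ is unique up to a unique isomorphism over $A$. *Statement.* Let $K$ be an MAEC and $\tau=\tau(K)$. Then there are a discrete language $\tau_1\supseteq\tau^+$ with $|\tau_1|=LS(K)$, a first-order $\tau_1$-theory $T_1$ and a set $\Gamma$ of $T_1$-types (in finitely many variables) such that * for every $M_1\models T_1$ that omits every type in $\Gamma$, the completion $\overline{M_1\upharpoonright\tau^+}$ with respect to $D$ exists; and * $K$ is exactly the class of these completions (up to isomorphism): a $\tau$-structure $M$ is in $K$ if and only if $M$ is the completion of $M_1\upharpoonright\tau^+$ with respect to $D$ for some $M_1\models T_1$ omitting $\Gamma$. -/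

import Mathlib

open Cardinal
open scoped FirstOrder

universe u

namespace MetricAEC

/-!
Signatures. A continuous signature consists of function symbols and (real-valued) relation symbols
with finite arities, which is the data of a `FirstOrder.Language`; the metric is a logical symbol
and is not listed. No moduli of uniform continuity are attached to the symbols.
-/

/-- A continuous structure: a nonempty complete metric space of diameter at most `1`, with
continuous (not necessarily uniformly continuous) functions and `[0,1]`-valued relations. -/
structure CStruct (τ : FirstOrder.Language.{u, u}) : Type (u + 1) where
  carrier : Type u
  [metric : MetricSpace carrier]
  [complete : CompleteSpace carrier]
  [nonempty : Nonempty carrier]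
  dist_le_one : ∀ x y : carrier, dist x y ≤ 1
  fn : ∀ {n : ℕ}, τ.Functions n → (Fin n → carrier) → carrier
  continuous_fn : ∀ {n : ℕ} (F : τ.Functions n), Continuous (fn F)
  rel : ∀ {n : ℕ}, τ.Relations n → (Fin n → carrier) → unitInterval
  continuous_rel : ∀ {n : ℕ} (R : τ.Relations n), Continuous (rel R)

attribute [instance] CStruct.metric CStruct.complete CStruct.nonempty

instance (τ : FirstOrder.Language.{u, u}) : CoeSort (CStruct τ) (Type u) := ⟨CStruct.carrier⟩

variable {τ : FirstOrder.Language.{u, u}}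

/-- `τ`-embeddings: isometric maps that commute with the functions and preserve the values of the
relations. Up to naming elements, `f : CEmb M N` presents `M` as a `τ`-substructure of `N`. -/
@[ext]
structure CEmb (M N : CStruct τ) where
  toFun : M → N
  isometry : Isometry toFun
  map_fn : ∀ {n : ℕ} (F : τ.Functions n) (x : Fin n → M),
    toFun (M.fn F x) = N.fn F (toFun ∘ x)
  map_rel : ∀ {n : ℕ} (R : τ.Relations n) (x : Fin n → M),
    N.rel R (toFun ∘ x) = M.rel R x

instance (M N : CStruct τ) : CoeFun (CEmb M N) (fun _ => M → N) := ⟨CEmb.toFun⟩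

/-- The identity embedding. -/
def CEmb.id (M : CStruct τ) : CEmb M M where
  toFun := fun x => x
  isometry := isometry_id
  map_fn := fun _ _ => rfl
  map_rel := fun _ _ => rfl

/-- Composition of embeddings. -/
def CEmb.comp {M N P : CStruct τ} (g : CEmb N P) (f : CEmb M N) : CEmb M P where
  toFun := fun x => g (f x)
  isometry := g.isometry.comp f.isometry
  map_fn := fun F x => by
    rw [f.map_fn, g.map_fn]; rfl
  map_rel := fun R x => by
    rw [← f.map_rel R x, ← g.map_rel R]; rfl

/-- Isomorphisms are the surjective embeddings. -/
def CEmb.IsIso {M N : CStruct τ} (f : CEmb M N) : Prop := Function.Surjective f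

/-- The density character of a topological space: the least cardinality of a dense subset. -/
noncomputable def densityCharacter (X : Type u) [TopologicalSpace X] : Cardinal.{u} :=
  sInf {κ : Cardinal.{u} | ∃ D : Set X, Dense D ∧ #D = κ}

/-- A continuous increasing chain of continuous structures, indexed by a well-order `I`
(equivalently, by an ordinal): at limit indices, the member of the chain is the closure of the
union of its predecessors. -/
structure Chain (τ : FirstOrder.Language.{u, u}) (I : Type u) [LinearOrder I] [WellFoundedLT I] where
  obj : I → CStruct τ
  map : ∀ {i j : I}, i ≤ j → CEmb (obj i) (obj j)
  map_refl : ∀ i (x : obj i), map (le_refl i) x = x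
  map_trans : ∀ {i j k : I} (hij : i ≤ j) (hjk : j ≤ k) (x : obj i),
    map hjk (map hij x) = map (hij.trans hjk) x
  continuous : ∀ i : I, Order.IsSuccLimit i →
    Dense {x : obj i | ∃ (j : I) (h : j < i) (y : obj j), map h.le y = x}

/-- A structure `N` containing all members of a chain, compatibly with the inclusions. -/
structure Chain.Cocone {I : Type u} [LinearOrder I] [WellFoundedLT I] (C : Chain τ I)
    (N : CStruct τ) where
  app : ∀ i, CEmb (C.obj i) N
  comm : ∀ {i j : I} (h : i ≤ j) (x : C.obj i), app j (C.map h x) = app i x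

/-- `N` is the completion of the union of the chain: the union is dense in `N`. -/
def Chain.Cocone.IsCompletionOfUnion {I : Type u} [LinearOrder I] [WellFoundedLT I]
    {C : Chain τ I} {N : CStruct τ} (g : C.Cocone N) : Prop :=
  Dense {x : N | ∃ (i : I) (y : C.obj i), g.app i y = x}

/-- A class `K` of continuous `τ`-structures (`Mem`) with a strong substructure relation.
`Strong f`, for `f : M → N`, says that `f` identifies `M` with a strong substructure of `N`,
that is, `f(M) ≺_K N`. -/
structure StrongClass (τ : FirstOrder.Language.{u, u}) where
  Mem : CStruct τ → Prop
  Strong : ∀ {M N : CStruct τ}, CEmb M N → Prop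

namespace StrongClass

variable (K : StrongClass τ)

/-- `μ` is an infinite cardinal, at least the number of symbols, that satisfies the
Löwenheim–Skolem property for `K`. -/
def IsLSCardinal (μ : Cardinal.{u}) : Prop :=
  ℵ₀ ≤ μ ∧ τ.card ≤ μ ∧
    ∀ M : CStruct τ, K.Mem M → ∀ A : Set M,
      ∃ (N : CStruct τ) (f : CEmb N M), K.Strong f ∧ A ⊆ Set.range f ∧
        densityCharacter N ≤ #A + μ

/-- The Löwenheim–Skolem number `LS(K)`: the least such cardinal. -/
noncomputable def LS : Cardinal.{u} := sInf {μ | K.IsLSCardinal μ}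

/-- The axioms of a metric abstract elementary class. Two axioms are built into the use of
embeddings: strong substructures are `τ`-substructures, and `≺_K` is antisymmetric. -/
structure IsMAEC : Prop where
  /-- `≺_K` is a relation on `K`. -/
  mem_of_strong : ∀ {M N : CStruct τ} (f : CEmb M N), K.Strong f → K.Mem M ∧ K.Mem N
  refl : ∀ M : CStruct τ, K.Mem M → K.Strong (CEmb.id M)
  trans : ∀ {M N P : CStruct τ} (f : CEmb M N) (g : CEmb N P),
    K.Strong f → K.Strong g → K.Strong (g.comp f)
  mem_iso : ∀ {N N' : CStruct τ} (e : CEmb N N'), e.IsIso → K.Mem N → K.Mem N'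
  strong_iso : ∀ {M N N' : CStruct τ} (f : CEmb M N) (e : CEmb N N'), e.IsIso →
    K.Strong f → K.Strong (e.comp f)
  coherence : ∀ {M₀ M₁ M₂ : CStruct τ} (f : CEmb M₀ M₁) (g : CEmb M₁ M₂),
    K.Strong (g.comp f) → K.Strong g → K.Strong f
  /-- The completion of the union of a nonempty continuous `≺_K`-increasing chain exists, belongs
  to `K`, and is a strong extension of all the members of the chain. -/
  chain_union : ∀ (I : Type u) [LinearOrder I] [WellFoundedLT I] [Nonempty I] (C : Chain τ I),
    (∀ {i j : I} (h : i ≤ j), K.Strong (C.map h)) →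
      ∃ (N : CStruct τ) (g : C.Cocone N), g.IsCompletionOfUnion ∧ K.Mem N ∧
        ∀ i, K.Strong (g.app i)
  /-- If all the members of the chain are strong in `P ∈ K`, then the completion of the union is
  strong in `P`. -/
  chain_bound : ∀ (I : Type u) [LinearOrder I] [WellFoundedLT I] [Nonempty I] (C : Chain τ I),
    (∀ {i j : I} (h : i ≤ j), K.Strong (C.map h)) →
      ∀ (N : CStruct τ) (g : C.Cocone N), g.IsCompletionOfUnion →
        ∀ (P : CStruct τ) (h : C.Cocone P), K.Mem P → (∀ i, K.Strong (h.app i)) →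
          ∃ k : CEmb N P, (∀ i (x : C.obj i), k (g.app i x) = h.app i x) ∧ K.Strong k
  exists_LS : ∃ μ : Cardinal.{u}, K.IsLSCardinal μ

end StrongClass

/-! The discrete language `τ⁺` and the continuous structure coded by a `τ⁺`-structure. -/

/-- The rational numbers in `[0,1]`. -/
def UnitRat : Type := {q : ℚ // 0 ≤ q ∧ q ≤ 1}

/-- The rational number, viewed as a real number. -/
def UnitRat.toReal (r : UnitRat) : ℝ := (r.1 : ℝ)

/-- The real-valued predicates of `τ`-structures: the metric and the relation symbols. -/
inductive PredSym (τ : FirstOrder.Language.{u, u}) : ℕ → Type u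
  | dist : PredSym τ 2
  | rel {n : ℕ} (R : τ.Relations n) : PredSym τ n

/-- The relation symbols of `τ⁺`: `R_{P ≥ r}` and `R_{P ≤ r}` for rational `r ∈ [0,1]`. -/
inductive PlusRel (τ : FirstOrder.Language.{u, u}) (n : ℕ) : Type u
  | ge (P : PredSym τ n) (r : UnitRat) : PlusRel τ n
  | le (P : PredSym τ n) (r : UnitRat) : PlusRel τ n

/-- The discrete language `τ⁺`. -/
def plusLanguage (τ : FirstOrder.Language.{u, u}) : FirstOrder.Language.{u, u} where
  Functions := τ.Functions
  Relations := PlusRel τ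

/-- The value of a real-valued predicate in a continuous structure. -/
def CStruct.pred (M : CStruct τ) : ∀ {n : ℕ}, PredSym τ n → (Fin n → M) → ℝ
  | _, .dist, x => Dist.dist (x 0) (x 1)
  | _, .rel R, x => (M.rel R x : ℝ)

section Plus

variable (τ) (A : Type u) [(plusLanguage τ).Structure A]

/-- `A ⊨ R_{P ≥ r}[a]`. -/
def HoldsGe {n : ℕ} (P : PredSym τ n) (r : UnitRat) (a : Fin n → A) : Prop :=
  FirstOrder.Language.Structure.RelMap (L := plusLanguage τ) (PlusRel.ge P r) a

/-- `A ⊨ R_{P ≤ r}[a]`. -/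
def HoldsLe {n : ℕ} (P : PredSym τ n) (r : UnitRat) (a : Fin n → A) : Prop :=
  FirstOrder.Language.Structure.RelMap (L := plusLanguage τ) (PlusRel.le P r) a

/-- The real value of the predicate `P` read off from a `τ⁺`-structure:
`sup {r ∈ ℚ ∩ [0,1] : A ⊨ R_{P ≥ r}[a]}`. For `P` the metric, this is the canonically definable
metric `D` on `A`. -/
noncomputable def derivedValue {n : ℕ} (P : PredSym τ n) (a : Fin n → A) : ℝ :=
  sSup {x : ℝ | ∃ r : UnitRat, x = r.toReal ∧ HoldsGe τ A P r a}

/-- The relations of the `τ⁺`-structure are exactly the comparisons of the derived values with the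
rationals in `[0,1]`; in particular the derived value is also
`inf {r ∈ ℚ ∩ [0,1] : A ⊨ R_{P ≤ r}[a]}`. -/
def IsCoherent : Prop :=
  ∀ {n : ℕ} (P : PredSym τ n) (r : UnitRat) (a : Fin n → A),
    (HoldsGe τ A P r a ↔ r.toReal ≤ derivedValue τ A P a) ∧
    (HoldsLe τ A P r a ↔ derivedValue τ A P a ≤ r.toReal)

/-- `M` is the completion, with respect to the derived metric, of the `τ`-prestructure coded by the
`τ⁺`-structure `A`: `A` is densely included in `M`, and the metric, the functions and the relations
of `M` extend those derived from `A`. As `M` is complete and its functions and relations are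
continuous, this determines `M` up to a unique isomorphism over `A`. -/
def IsCompletion (M : CStruct τ) : Prop :=
  IsCoherent τ A ∧
  ∃ ι : A → M, Function.Injective ι ∧ DenseRange ι ∧
    (∀ {n : ℕ} (F : τ.Functions n) (a : Fin n → A),
      ι (FirstOrder.Language.Structure.funMap (L := plusLanguage τ) F a) = M.fn F (ι ∘ a)) ∧
    (∀ {n : ℕ} (P : PredSym τ n) (a : Fin n → A),
      M.pred P (ι ∘ a) = derivedValue τ A P a)

end Plus

/-- `M₁` omits every type in `Γ`, where `Γ n` consists of `n`-types of `T₁`. -/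
def Omits {τ₁ : FirstOrder.Language.{u, u}} (T₁ : τ₁.Theory)
    (Γ : ∀ n : ℕ, Set (T₁.CompleteType (Fin n))) (M₁ : T₁.ModelType.{u, u, u}) : Prop :=
  ∀ n : ℕ, ∀ p ∈ Γ n, p ∉ T₁.realizedTypes M₁ (Fin n)

/-- `M` is the completion of the reduct of the `τ₁`-structure `M₁` along `φ : τ⁺ → τ₁`. -/
def IsCompletionOfReduct {τ₁ : FirstOrder.Language.{u, u}} (φ : plusLanguage τ →ᴸ τ₁)
    (M₁ : Type u) [τ₁.Structure M₁] (M : CStruct τ) : Prop :=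
  @IsCompletion τ M₁ (φ.reduct M₁) M

end MetricAEC

namespace MetricAEC

variable {τ : FirstOrder.Language.{u, u}}

open FirstOrder.Language.Structure (funMap RelMap)

/-! ### Real values and rational cuts -/

/-! Add to `τ⁺` exactly `LS(K)` function symbols of each arity and take `T₁` empty. Call a
`τ₁`-structure good if, for all `X ⊆ Y` with `Y` finite, the substructures generated by `X` and `Y`
have completions in `K`, the first strong in the second. `Γ` consists of the types realized in no
good structure. Whether the condition holds at a tuple depends only on which atomic formulas the
tuple satisfies, so omitting `Γ` is the same as being good (`omits_badTypes_iff`).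

A good structure has its completion in `K`: the chain axioms, applied by induction on cardinality,
carry strength from finite generating sets to arbitrary ones (`isStrong_of_finite`), in particular
to the whole structure.

Conversely, let `M ∈ K`. Löwenheim–Skolem yields a monotone family of sets `E c`, for `c` a finite
subset of `M`, each of size at most `LS(K)` and with closure strong in `M`. The new functions
enumerate `E {x₁, …, xₙ}`, so a substructure `S` contains `E c` for every finite `c ⊆ S`. Then `S`
has the same closure as the directed union of the `closure (E c)`, which is strong in `M`
(`isStrong_univ_of_finset`); coherence makes `M` itself a good structure.

Everything is done with subsets `S` of one discrete structure. The completion of `S` is unique up to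
isomorphism over `S` (`IsPres.exists_cemb`), so strength becomes a relation between sets, and chains
of structures become chains of sets. -/

lemma UnitRat.exists_between {u v : ℝ} (hu : 0 ≤ u) (hv : v ≤ 1) (huv : u < v) :
    ∃ r : UnitRat, u < r.toReal ∧ r.toReal < v := by
  obtain ⟨q, h1, h2⟩ := exists_rat_btwn huv
  exact ⟨⟨q, by exact_mod_cast (hu.trans h1.le), by exact_mod_cast (h2.le.trans hv)⟩, h1, h2⟩

lemma le_of_forall_unitRat {u v : ℝ} (hu : u ≤ 1) (hv : 0 ≤ v)
    (h : ∀ r : UnitRat, r.toReal ≤ u → r.toReal ≤ v) : u ≤ v := by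
  by_contra hlt
  obtain ⟨r, h1, h2⟩ := UnitRat.exists_between hv hu (not_le.1 hlt)
  exact absurd (h r h2.le) (not_le.2 h1)

lemma CStruct.pred_nonneg (M : CStruct τ) {n : ℕ} (P : PredSym τ n) (x : Fin n → M) :
    0 ≤ M.pred P x := by
  cases P with
  | dist => exact dist_nonneg
  | rel R => exact (M.rel R x).2.1

lemma CStruct.pred_le_one (M : CStruct τ) {n : ℕ} (P : PredSym τ n) (x : Fin n → M) :
    M.pred P x ≤ 1 := by
  cases P with
  | dist => exact M.dist_le_one _ _
  | rel R => exact (M.rel R x).2.2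

lemma CEmb.map_pred {M N : CStruct τ} (f : CEmb M N) {n : ℕ} (P : PredSym τ n) (x : Fin n → M) :
    N.pred P (f ∘ x) = M.pred P x := by
  cases P with
  | dist => exact f.isometry.dist_eq _ _
  | rel R => exact congrArg Subtype.val (f.map_rel R x)

lemma derivedValue_eq {A : Type u} [(plusLanguage τ).Structure A] {n : ℕ} {P : PredSym τ n}
    {a : Fin n → A} {v : ℝ} (h0 : 0 ≤ v) (h1 : v ≤ 1)
    (h : ∀ r : UnitRat, HoldsGe τ A P r a ↔ r.toReal ≤ v) : derivedValue τ A P a = v := by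
  -- The cut always contains `0`, so the supremum is taken over a nonempty set.
  have hz : HoldsGe τ A P ⟨0, le_rfl, zero_le_one⟩ a := (h _).2 (by simpa [UnitRat.toReal] using h0)
  have hb : ∀ x ∈ {x : ℝ | ∃ r : UnitRat, x = r.toReal ∧ HoldsGe τ A P r a}, x ≤ v := by
    rintro x ⟨r, rfl, hr⟩
    exact (h r).1 hr
  have hmem : ∀ r : UnitRat, HoldsGe τ A P r a → r.toReal ≤ derivedValue τ A P a :=
    fun r hr => le_csSup ⟨v, hb⟩ ⟨r, rfl, hr⟩
  refine le_antisymm (csSup_le ⟨_, _, rfl, hz⟩ hb) (le_of_forall_unitRat h1 ?_ fun r hr => ?_)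
  · simpa [UnitRat.toReal] using hmem _ hz
  · exact hmem r ((h r).2 hr)

/-! ### Presentations of continuous structures by discrete ones -/

/-- The restriction of `ι` to the subset `S` of the `τ⁺`-structure `A` presents the continuous
structure `M` as the completion of the `τ⁺`-substructure with universe `S`. -/
structure IsPres {A : Type u} [(plusLanguage τ).Structure A] (S : Set A) (M : CStruct τ)
    (ι : A → M) : Prop where
  injOn : Set.InjOn ι S
  dense : Dense (ι '' S)
  fn_mem : ∀ {n : ℕ} (F : τ.Functions n) (a : Fin n → A), (∀ i, a i ∈ S) →
    funMap (L := plusLanguage τ) F a ∈ S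
  map_fn : ∀ {n : ℕ} (F : τ.Functions n) (a : Fin n → A), (∀ i, a i ∈ S) →
    ι (funMap (L := plusLanguage τ) F a) = M.fn F (ι ∘ a)
  ge_iff : ∀ {n : ℕ} (P : PredSym τ n) (r : UnitRat) (a : Fin n → A), (∀ i, a i ∈ S) →
    (HoldsGe τ A P r a ↔ r.toReal ≤ M.pred P (ι ∘ a))
  le_iff : ∀ {n : ℕ} (P : PredSym τ n) (r : UnitRat) (a : Fin n → A), (∀ i, a i ∈ S) →
    (HoldsLe τ A P r a ↔ M.pred P (ι ∘ a) ≤ r.toReal)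

section Pres

variable {A : Type u} [(plusLanguage τ).Structure A]

/-- A number in `[0,1]` is determined by its rational cut, so the derived values can be eliminated
in favour of direct comparisons with the values in `M`. -/
lemma isCompletion_iff {M : CStruct τ} :
    IsCompletion τ A M ↔ ∃ ι : A → M, IsPres Set.univ M ι := by
  constructor
  · rintro ⟨hc, ι, hi, hd, hf, hp⟩
    refine ⟨ι, hi.injOn, by rw [Set.image_univ]; exact hd, fun _ _ _ => trivial,
      fun F a _ => hf F a, fun P r a _ => ?_, fun P r a _ => ?_⟩
    · rw [hp]; exact (hc P r a).1
    · rw [hp]; exact (hc P r a).2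
  · rintro ⟨ι, h⟩
    have hv : ∀ {n : ℕ} (P : PredSym τ n) (a : Fin n → A),
        derivedValue τ A P a = M.pred P (ι ∘ a) := fun P a =>
      derivedValue_eq (M.pred_nonneg _ _) (M.pred_le_one _ _)
        fun r => h.ge_iff P r a fun _ => trivial
    refine ⟨fun P r a => ?_, ι, Set.injOn_univ.1 h.injOn,
      by rw [DenseRange, ← Set.image_univ]; exact h.dense,
      fun F a => h.map_fn F a fun _ => trivial, fun P a => (hv P a).symm⟩
    rw [hv]
    exact ⟨h.ge_iff P r a fun _ => trivial, h.le_iff P r a fun _ => trivial⟩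

namespace IsPres

variable {S T : Set A} {M N : CStruct τ} {ι : A → M} {κ : A → N}

/-- Both values have the same rational cut, namely the one recorded by the relations of `A`. -/
lemma pred_eq (h : IsPres S M ι) (h' : IsPres T N κ) (hST : S ⊆ T) {n : ℕ} (P : PredSym τ n)
    (a : Fin n → A) (ha : ∀ i, a i ∈ S) : N.pred P (κ ∘ a) = M.pred P (ι ∘ a) := by
  have key : ∀ r : UnitRat, r.toReal ≤ N.pred P (κ ∘ a) ↔ r.toReal ≤ M.pred P (ι ∘ a) := fun r =>
    (h'.ge_iff P r a fun i => hST (ha i)).symm.trans (h.ge_iff P r a ha)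
  exact le_antisymm
    (le_of_forall_unitRat (N.pred_le_one _ _) (M.pred_nonneg _ _) fun r => (key r).1)
    (le_of_forall_unitRat (M.pred_le_one _ _) (N.pred_nonneg _ _) fun r => (key r).2)

lemma dist_eq (h : IsPres S M ι) (h' : IsPres T N κ) (hST : S ⊆ T) {a b : A} (ha : a ∈ S)
    (hb : b ∈ S) : dist (κ a) (κ b) = dist (ι a) (ι b) :=
  h.pred_eq h' hST .dist ![a, b] (by simp [Fin.forall_fin_two, ha, hb])

end IsPres

end Pres

/-- An isometric map from a dense set into a complete space extends to the whole space. -/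
lemma exists_isometry_extend {A X Y : Type*} [MetricSpace X] [MetricSpace Y] [CompleteSpace Y]
    {S : Set A} {ι : A → X} {κ : A → Y} (hd : Dense (ι '' S))
    (h : ∀ a ∈ S, ∀ b ∈ S, dist (κ a) (κ b) = dist (ι a) (ι b)) :
    ∃ f : X → Y, Isometry f ∧ ∀ a ∈ S, f (ι a) = κ a := by
  -- `A` carries no metric; distances are pulled back along `ι`, which is not assumed injective.
  let _ : PseudoMetricSpace S := PseudoMetricSpace.induced (fun a : S => ι a) inferInstance
  have hi : Isometry (fun a : S => ι a) := Isometry.of_dist_eq fun _ _ => rfl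
  have hκ : Isometry (fun a : S => κ a) := Isometry.of_dist_eq fun a b => h a a.2 b b.2
  have hr : DenseRange (fun a : S => ι a) := by
    rwa [DenseRange, ← Set.image_eq_range]
  have hdi := hi.isUniformInducing.isDenseInducing hr
  have huc : UniformContinuous (hdi.extend (fun a : S => κ a)) :=
    uniformContinuous_uniformly_extend hi.isUniformInducing hr hκ.uniformContinuous
  have hf : ∀ a : S, hdi.extend (fun a : S => κ a) (ι a) = κ a := fun a =>
    uniformly_extend_of_ind hi.isUniformInducing hr hκ.uniformContinuous a
  refine ⟨_, Isometry.of_dist_eq fun x y => ?_, fun a ha => hf ⟨a, ha⟩⟩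
  refine hr.induction_on₂ (p := fun x y => dist (hdi.extend (fun a : S => κ a) x)
    (hdi.extend (fun a : S => κ a) y) = dist x y) (isClosed_eq ?_ ?_) (fun a b => ?_) x y
  · exact (huc.continuous.comp continuous_fst).dist (huc.continuous.comp continuous_snd)
  · exact continuous_fst.dist continuous_snd
  · simp only [hf]
    exact h a a.2 b b.2

lemma CEmb.ext_of_dense {M N : CStruct τ} {f g : CEmb M N} {D : Set M} (hD : Dense D)
    (h : ∀ x ∈ D, f x = g x) : f = g :=
  CEmb.ext (Continuous.ext_on hD f.isometry.continuous g.isometry.continuous h)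

lemma dense_forall_mem {X : Type*} [TopologicalSpace X] {D : Set X} (hD : Dense D) (n : ℕ) :
    Dense {x : Fin n → X | ∀ i, x i ∈ D} := by
  simpa [Set.pi] using dense_pi (Set.univ : Set (Fin n)) (s := fun _ => D) fun _ _ => hD

lemma exists_lift_of_image {A X : Type*} {S : Set A} {ι : A → X} {n : ℕ} {x : Fin n → X}
    (hx : ∀ i, x i ∈ ι '' S) : ∃ a : Fin n → A, (∀ i, a i ∈ S) ∧ ι ∘ a = x := by
  choose a ha using hx
  exact ⟨a, fun i => (ha i).1, funext fun i => (ha i).2⟩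

section Pres

variable {A : Type u} [(plusLanguage τ).Structure A]

namespace IsPres

variable {S T : Set A} {M N : CStruct τ} {ι : A → M} {κ : A → N}

/-- The relations of `A` fix the distances on `S`, so `ι a ↦ κ a` is isometric and extends to `M`.
Commutation with functions and relations is an equality of continuous maps on a dense set of tuples;
uniform continuity of the symbols is not needed. -/
lemma exists_cemb (h : IsPres S M ι) (h' : IsPres T N κ) (hST : S ⊆ T) :
    ∃ f : CEmb M N, ∀ a ∈ S, f (ι a) = κ a := by
  obtain ⟨f, hf, hfa⟩ := exists_isometry_extend h.dense fun a ha b hb => h.dist_eq h' hST ha hb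
  have hcomp : ∀ {n : ℕ}, Continuous fun x : Fin n → M => f ∘ x := fun {n} =>
    continuous_pi fun i => hf.continuous.comp (continuous_apply i)
  have hfc : ∀ {n : ℕ} (a : Fin n → A), (∀ i, a i ∈ S) → f ∘ ι ∘ a = κ ∘ a := fun a ha =>
    funext fun i => hfa _ (ha i)
  refine ⟨⟨f, hf, fun {n} F x => ?_, fun {n} R x => ?_⟩, hfa⟩
  · refine congrFun (Continuous.ext_on (dense_forall_mem h.dense n)
      (hf.continuous.comp (M.continuous_fn F)) ((N.continuous_fn F).comp hcomp) ?_) x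
    intro x hx
    obtain ⟨a, ha, rfl⟩ := exists_lift_of_image hx
    simp only [Function.comp_apply]
    rw [hfc a ha, ← h.map_fn F a ha, ← h'.map_fn F a fun i => hST (ha i), hfa _ (h.fn_mem F a ha)]
  · refine congrFun (Continuous.ext_on (dense_forall_mem h.dense n)
      ((N.continuous_rel R).comp hcomp) (M.continuous_rel R) ?_) x
    intro x hx
    obtain ⟨a, ha, rfl⟩ := exists_lift_of_image hx
    simp only [Function.comp_apply]
    rw [hfc a ha]
    exact Subtype.ext (h.pred_eq h' hST (.rel R) a ha)

/-- Two presentations of the same set are isomorphic. -/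
lemma exists_iso (h : IsPres S M ι) (h' : IsPres S N κ) :
    ∃ (e : CEmb M N) (e' : CEmb N M), e.IsIso ∧ e'.IsIso ∧ (∀ a ∈ S, e (ι a) = κ a) ∧
      (∀ a ∈ S, e' (κ a) = ι a) ∧ (∀ x, e' (e x) = x) ∧ ∀ y, e (e' y) = y := by
  obtain ⟨e, he⟩ := h.exists_cemb h' subset_rfl
  obtain ⟨e', he'⟩ := h'.exists_cemb h subset_rfl
  have h1 : e'.comp e = CEmb.id M := CEmb.ext_of_dense h.dense <| by
    rintro _ ⟨a, ha, rfl⟩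
    simp [CEmb.comp, CEmb.id, he a ha, he' a ha]
  have h2 : e.comp e' = CEmb.id N := CEmb.ext_of_dense h'.dense <| by
    rintro _ ⟨a, ha, rfl⟩
    simp [CEmb.comp, CEmb.id, he a ha, he' a ha]
  have h1' : ∀ x, e' (e x) = x := fun x => congrFun (congrArg CEmb.toFun h1) x
  have h2' : ∀ x, e (e' x) = x := fun x => congrFun (congrArg CEmb.toFun h2) x
  exact ⟨e, e', fun y => ⟨_, h2' y⟩, fun y => ⟨_, h1' y⟩, he, he', h1', h2'⟩

/-- Presentations are pulled back along maps that are embeddings on the set in question. -/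
lemma comap {B : Type u} [(plusLanguage τ).Structure B] {S' : Set B} {ι' : B → M}
    (h : IsPres S' M ι') (g : A → B) (himg : g '' S = S') (hinj : Set.InjOn g S)
    (hmem : ∀ {n : ℕ} (F : τ.Functions n) (a : Fin n → A), (∀ i, a i ∈ S) →
      funMap (L := plusLanguage τ) F a ∈ S)
    (hfn : ∀ {n : ℕ} (F : τ.Functions n) (a : Fin n → A), (∀ i, a i ∈ S) →
      g (funMap (L := plusLanguage τ) F a) = funMap (L := plusLanguage τ) F (g ∘ a))
    (hrel : ∀ {n : ℕ} (R : PlusRel τ n) (a : Fin n → A), (∀ i, a i ∈ S) →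
      (RelMap (L := plusLanguage τ) R a ↔ RelMap (L := plusLanguage τ) R (g ∘ a))) :
    IsPres S M (ι' ∘ g) := by
  subst himg
  have hg : ∀ {n : ℕ} (a : Fin n → A), (∀ i, a i ∈ S) → ∀ i, (g ∘ a) i ∈ g '' S :=
    fun a ha i => ⟨_, ha i, rfl⟩
  refine ⟨h.injOn.comp hinj (Set.mapsTo_image g S), ?_, hmem, fun F a ha => ?_,
    fun P r a ha => ?_, fun P r a ha => ?_⟩
  · rw [Set.image_comp]; exact h.dense
  · rw [Function.comp_apply, hfn F a ha, h.map_fn F _ (hg a ha)]; rfl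
  · exact (hrel _ a ha).trans (h.ge_iff P r _ (hg a ha))
  · exact (hrel _ a ha).trans (h.le_iff P r _ (hg a ha))

end IsPres

end Pres

/-! ### The strong substructure relation between presented structures -/

/-- `S ⊆ T` present continuous structures in `K` such that the first is strong in the second. -/
def StrongClass.IsStrong (K : StrongClass τ) {A : Type u} [(plusLanguage τ).Structure A]
    (S T : Set A) : Prop :=
  S ⊆ T ∧ ∃ (M N : CStruct τ) (ι : A → M) (κ : A → N) (f : CEmb M N),
    IsPres S M ι ∧ IsPres T N κ ∧ (∀ a ∈ S, f (ι a) = κ a) ∧ K.Strong f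

namespace StrongClass

variable {K : StrongClass τ} {A : Type u} [(plusLanguage τ).Structure A]

/-- The axioms give invariance only under isomorphisms of the larger structure. With transitivity,
this lemma also allows precomposition with an isomorphism. -/
lemma IsMAEC.strong_of_isIso (hK : K.IsMAEC) {M N : CStruct τ} (e : CEmb M N) (he : e.IsIso)
    (hM : K.Mem M) : K.Strong e :=
  hK.strong_iso (CEmb.id M) e he (hK.refl M hM)

namespace IsStrong

variable {S T W : Set A}

/-- The relation `IsStrong` does not depend on the choice of the presentations. -/
lemma strong (hK : K.IsMAEC) (h : K.IsStrong S T) {M N : CStruct τ} {ι : A → M} {κ : A → N}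
    (hι : IsPres S M ι) (hκ : IsPres T N κ) (f : CEmb M N) (hf : ∀ a ∈ S, f (ι a) = κ a) :
    K.Strong f := by
  obtain ⟨hST, M', N', ι', κ', f', hι', hκ', hf', hs⟩ := h
  obtain ⟨e, e', he, he', hea, hea', -, -⟩ := hι.exists_iso hι'
  obtain ⟨d, d', hd, hd', hda, hda', -, -⟩ := hκ.exists_iso hκ'
  have heq : f = d'.comp (f'.comp e) := CEmb.ext_of_dense hι.dense <| by
    rintro _ ⟨a, ha, rfl⟩
    simp [CEmb.comp, hf a ha, hea a ha, hf' a ha, hda' a (hST ha)]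
  have hM' : K.Mem M' := (hK.mem_of_strong _ hs).1
  rw [heq]
  exact hK.strong_iso _ _ hd' (hK.trans _ _
    (hK.strong_of_isIso e he (hK.mem_iso e' he' hM')) hs)

lemma exists_pres_left (hK : K.IsMAEC) (h : K.IsStrong S T) :
    ∃ (M : CStruct τ) (ι : A → M), IsPres S M ι ∧ K.Mem M := by
  obtain ⟨-, M, N, ι, κ, f, hι, -, -, hf⟩ := h
  exact ⟨M, ι, hι, (hK.mem_of_strong f hf).1⟩

lemma exists_pres_right (hK : K.IsMAEC) (h : K.IsStrong S T) :
    ∃ (M : CStruct τ) (ι : A → M), IsPres T M ι ∧ K.Mem M := by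
  obtain ⟨-, M, N, ι, κ, f, -, hκ, -, hf⟩ := h
  exact ⟨N, κ, hκ, (hK.mem_of_strong f hf).2⟩

lemma trans (hK : K.IsMAEC) (h : K.IsStrong S T) (h' : K.IsStrong T W) : K.IsStrong S W := by
  obtain ⟨M, ι, hι, -⟩ := h.exists_pres_left hK
  obtain ⟨hTW, N, P, κ, l, g, hκ, hl, hg, hgs⟩ := h'
  obtain ⟨f, hf⟩ := hι.exists_cemb hκ h.1
  refine ⟨h.1.trans hTW, M, P, ι, l, g.comp f, hι, hl, fun a ha => ?_,
    hK.trans _ _ (h.strong hK hι hκ f hf) hgs⟩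
  simp [CEmb.comp, hf a ha, hg a (h.1 ha)]

lemma coherence (hK : K.IsMAEC) (hST : S ⊆ T) (h : K.IsStrong S W) (h' : K.IsStrong T W) :
    K.IsStrong S T := by
  obtain ⟨M, ι, hι, -⟩ := h.exists_pres_left hK
  obtain ⟨hTW, N, P, κ, l, g, hκ, hl, hg, hgs⟩ := h'
  obtain ⟨f, hf⟩ := hι.exists_cemb hκ hST
  refine ⟨hST, M, N, ι, κ, f, hι, hκ, hf, hK.coherence f g ?_ hgs⟩
  refine h.strong hK hι hl _ fun a ha => ?_
  simp [CEmb.comp, hf a ha, hg a (hST ha)]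

end IsStrong

/-! ### Unions of chains of presented structures -/

section Chain

variable {I : Type u} [LinearOrder I] [WellFoundedLT I] {V : I → Set A}

/-- A continuous `IsStrong`-increasing chain of sets yields a chain of continuous structures. -/
lemma exists_chain (hK : K.IsMAEC) (hV : ∀ i j, i ≤ j → K.IsStrong (V i) (V j))
    (hlim : ∀ i, Order.IsSuccLimit i → V i ⊆ ⋃ j < i, V j) :
    ∃ (C : Chain τ I) (ι : ∀ i, A → C.obj i), (∀ i, IsPres (V i) (C.obj i) (ι i)) ∧
      (∀ {i j} (h : i ≤ j), ∀ a ∈ V i, C.map h (ι i a) = ι j a) ∧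
      ∀ {i j} (h : i ≤ j), K.Strong (C.map h) := by
  choose M ι hι _ using fun i => (hV i i le_rfl).exists_pres_left hK
  choose f hf using fun (i j : I) (h : i ≤ j) => (hι i).exists_cemb (hι j) (hV i j h).1
  refine ⟨⟨M, fun {i j} h => f i j h, fun i x => ?_, fun {i j k} hij hjk x => ?_, fun i hi => ?_⟩,
    ι, hι, fun {i j} h => hf i j h,
    fun {i j} h => (hV i j h).strong hK (hι i) (hι j) _ (hf i j h)⟩
  · have : f i i le_rfl = CEmb.id (M i) := CEmb.ext_of_dense (hι i).dense <| by
      rintro _ ⟨a, ha, rfl⟩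
      simp [CEmb.id, hf i i le_rfl a ha]
    rw [this]; rfl
  · have : (f j k hjk).comp (f i j hij) = f i k (hij.trans hjk) :=
      CEmb.ext_of_dense (hι i).dense <| by
        rintro _ ⟨a, ha, rfl⟩
        simp [CEmb.comp, hf i j hij a ha, hf j k hjk a ((hV i j hij).1 ha), hf i k _ a ha]
    exact congrFun (congrArg CEmb.toFun this) x
  · refine (hι i).dense.mono ?_
    rintro _ ⟨a, ha, rfl⟩
    obtain ⟨j, hj, haj⟩ : ∃ j, ∃ _ : j < i, a ∈ V j := by simpa using hlim i hi ha
    exact ⟨j, hj, ι j a, hf j i hj.le a haj⟩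

/-- A structure that completes the union of a chain is presented by the union of the
presentations. -/
lemma exists_isPres_iUnion {C : Chain τ I} {ι : ∀ i, A → C.obj i} (hmono : Monotone V)
    (hι : ∀ i, IsPres (V i) (C.obj i) (ι i))
    (hmap : ∀ {i j} (h : i ≤ j), ∀ a ∈ V i, C.map h (ι i a) = ι j a)
    {N : CStruct τ} (g : C.Cocone N) (hg : g.IsCompletionOfUnion) :
    ∃ κ : A → N, IsPres (⋃ i, V i) N κ ∧ ∀ i, ∀ a ∈ V i, g.app i (ι i a) = κ a := by
  classical
  have hex : ∀ a : A, ∃ x : N, ∀ i, a ∈ V i → g.app i (ι i a) = x := fun a => by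
    by_cases h : ∃ i, a ∈ V i
    · obtain ⟨i, hi⟩ := h
      refine ⟨g.app i (ι i a), fun j hj => ?_⟩
      rcases le_total i j with hij | hij
      · rw [← hmap hij a hi, g.comm]
      · rw [← hmap hij a hj, g.comm]
    -- Outside the union the value of `κ` is irrelevant.
    · exact ⟨Classical.arbitrary N, fun i hi => absurd ⟨i, hi⟩ h⟩
  choose κ hκ using hex
  have hfin : ∀ {n : ℕ} (a : Fin n → A), (∀ k, a k ∈ ⋃ i, V i) → Nonempty I →
      ∃ i, ∀ k, a k ∈ V i := fun {n} a ha _ => by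
    choose i hi using fun k => Set.mem_iUnion.1 (ha k)
    obtain ⟨j, hj⟩ := (Set.finite_range i).bddAbove
    exact ⟨j, fun k => hmono (hj ⟨k, rfl⟩) (hi k)⟩
  have hcomp : ∀ {n : ℕ} (a : Fin n → A) i, (∀ k, a k ∈ V i) → κ ∘ a = g.app i ∘ ι i ∘ a :=
    fun a i ha => funext fun k => (hκ _ i (ha k)).symm
  have hne : Nonempty I := by
    obtain ⟨x, i, -⟩ := hg.nonempty
    exact ⟨i⟩
  refine ⟨κ, ⟨fun a ha b hb hab => ?_, ?_, fun F a ha => ?_, fun F a ha => ?_, fun P r a ha => ?_,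
    fun P r a ha => ?_⟩, fun i a ha => hκ a i ha⟩
  · obtain ⟨i, hi⟩ := hfin ![a, b] (Fin.forall_fin_two.2 ⟨ha, hb⟩) hne
    have hai : a ∈ V i := hi 0
    have hbi : b ∈ V i := hi 1
    rw [← hκ a i hai, ← hκ b i hbi] at hab
    exact (hι i).injOn hai hbi ((g.app i).isometry.injective hab)
  · refine dense_iff_closure_eq.2 (Set.eq_univ_of_univ_subset ?_)
    rw [← hg.closure_eq]
    refine closure_minimal ?_ isClosed_closure
    rintro _ ⟨i, y, rfl⟩
    have hy : y ∈ closure (ι i '' V i) := (hι i).dense y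
    refine closure_mono ?_ (image_closure_subset_closure_image (g.app i).isometry.continuous
      ⟨y, hy, rfl⟩)
    rintro _ ⟨_, ⟨a, ha, rfl⟩, rfl⟩
    exact ⟨a, Set.mem_iUnion.2 ⟨i, ha⟩, (hκ a i ha).symm⟩
  · obtain ⟨i, hi⟩ := hfin a ha hne
    exact Set.mem_iUnion.2 ⟨i, (hι i).fn_mem F a hi⟩
  · obtain ⟨i, hi⟩ := hfin a ha hne
    rw [← hκ _ i ((hι i).fn_mem F a hi), (hι i).map_fn F a hi, (g.app i).map_fn, hcomp a i hi]
  · obtain ⟨i, hi⟩ := hfin a ha hne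
    rw [hcomp a i hi, CEmb.map_pred]
    exact (hι i).ge_iff P r a hi
  · obtain ⟨i, hi⟩ := hfin a ha hne
    rw [hcomp a i hi, CEmb.map_pred]
    exact (hι i).le_iff P r a hi

/-- The chain axiom in terms of sets: the completion it provides is presented by the union of the
chain. -/
lemma isStrong_iUnion [Nonempty I] (hK : K.IsMAEC) (hV : ∀ i j, i ≤ j → K.IsStrong (V i) (V j))
    (hlim : ∀ i, Order.IsSuccLimit i → V i ⊆ ⋃ j < i, V j) (i : I) :
    K.IsStrong (V i) (⋃ i, V i) := by
  obtain ⟨C, ι, hι, hmap, hs⟩ := exists_chain hK hV hlim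
  obtain ⟨N, g, hg, -, hgs⟩ := hK.chain_union I C hs
  obtain ⟨κ, hκ, hgκ⟩ := exists_isPres_iUnion (fun i j h => (hV i j h).1) hι hmap g hg
  exact ⟨Set.subset_iUnion V i, _, N, ι i, κ, g.app i, hι i, hκ, hgκ i, hgs i⟩

/-- The second half of the chain axiom. The cocone into the structure presented by `T` comes from
extending the inclusions `V i ⊆ T`; its compatibility is checked on dense sets. -/
lemma iUnion_isStrong [Nonempty I] (hK : K.IsMAEC) (hV : ∀ i j, i ≤ j → K.IsStrong (V i) (V j))
    (hlim : ∀ i, Order.IsSuccLimit i → V i ⊆ ⋃ j < i, V j) {T : Set A}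
    (hT : ∀ i, K.IsStrong (V i) T) : K.IsStrong (⋃ i, V i) T := by
  obtain ⟨C, ι, hι, hmap, hs⟩ := exists_chain hK hV hlim
  obtain ⟨N, g, hg, -, -⟩ := hK.chain_union I C hs
  obtain ⟨κ, hκ, hgκ⟩ := exists_isPres_iUnion (fun i j h => (hV i j h).1) hι hmap g hg
  obtain ⟨P, l, hl, hP⟩ := (hT (Classical.arbitrary I)).exists_pres_right hK
  choose f hf using fun i => (hι i).exists_cemb hl (hT i).1
  have hfs : ∀ i, K.Strong (f i) := fun i => (hT i).strong hK (hι i) hl _ (hf i)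
  have hcomm : ∀ {i j : I} (h : i ≤ j), (f j).comp (C.map h) = f i := fun {i j} h =>
    CEmb.ext_of_dense (hι i).dense <| by
      rintro _ ⟨a, ha, rfl⟩
      simp [CEmb.comp, hmap h a ha, hf i a ha, hf j a ((hV i j h).1 ha)]
  obtain ⟨k, hk, hks⟩ := hK.chain_bound I C hs N g hg P
    ⟨f, fun h x => congrFun (congrArg CEmb.toFun (hcomm h)) x⟩ hP hfs
  refine ⟨Set.iUnion_subset fun i => (hT i).1, N, P, κ, l, k, hκ, hl, fun a ha => ?_, hks⟩
  obtain ⟨i, hi⟩ := Set.mem_iUnion.1 ha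
  rw [← hgκ i a hi, hk, hf i a hi]

end Chain

/-! ### Directed unions -/

/-- If a finitary monotone operator `U` is `IsStrong`-increasing on finite sets, then it is so on
all sets. -/
lemma isStrong_of_finite (hK : K.IsMAEC) {X₀ : Type u} {U : Set X₀ → Set A}
    (hmono : Monotone U) (hfin : ∀ X, ∀ a ∈ U X, ∃ F ⊆ X, F.Finite ∧ a ∈ U F)
    (h : ∀ X Y, Y.Finite → X ⊆ Y → K.IsStrong (U X) (U Y)) (X Y : Set X₀) (hXY : X ⊆ Y) :
    K.IsStrong (U X) (U Y) := by
  induction hκ : #Y using WellFoundedLT.induction generalizing X Y with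
  | ind κ ih =>
  subst hκ
  rcases Y.finite_or_infinite with hY | hY
  · exact h X Y hY hXY
  have hinf : ℵ₀ ≤ #Y := Cardinal.aleph0_le_mk_iff.2 hY.to_subtype
  let I := (#Y).ord.ToType
  obtain ⟨e⟩ : Nonempty (I ≃ Y) := Cardinal.eq.1 (Cardinal.mk_ord_toType _)
  have : NoMaxOrder I := Cardinal.noMaxOrder hinf
  have : Nonempty I := by
    obtain ⟨y, hy⟩ := hY.nonempty
    exact ⟨e.symm ⟨y, hy⟩⟩
  -- `Y` is enumerated in the order type of its cardinal. Proper initial segments have smaller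
  -- cardinality, so the induction hypothesis applies to them, and as there is no last index they
  -- exhaust `Y`.
  let Z : I → Set X₀ := fun i => {x | ∃ j < i, (e j : X₀) = x}
  have hZmono : Monotone Z := fun i j hij x ⟨k, hk, hx⟩ => ⟨k, hk.trans_le hij, hx⟩
  have hZY : ∀ i, Z i ⊆ Y := by
    rintro i _ ⟨j, -, rfl⟩
    exact (e j).2
  have hcard : ∀ i, #(Z i) < #Y := fun i => by
    have h1 : Z i = (fun j => (e j : X₀)) '' Set.Iio i := rfl
    rw [h1]
    exact Cardinal.mk_image_le.trans_lt (by simpa [I] using Cardinal.mk_Iio_lt i (by simp [I]))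
  have hchain : ∀ X ⊆ Y, ∀ i j, i ≤ j → K.IsStrong (U (X ∩ Z i)) (U (X ∩ Z j)) :=
    fun X hX i j hij => ih _ ((Cardinal.mk_le_mk_of_subset Set.inter_subset_right).trans_lt
      (hcard j)) _ _ (Set.inter_subset_inter_right _ (hZmono hij)) rfl
  have hfinZ : ∀ (J : Set I), J.Nonempty → ∀ F : Set X₀, F.Finite → (∀ x ∈ F, ∃ i ∈ J, x ∈ Z i) →
      ∃ i ∈ J, F ⊆ Z i := fun J hJ F hF => by
    induction F, hF using Set.Finite.induction_on with
    | empty => exact fun _ => ⟨hJ.some, hJ.some_mem, Set.empty_subset _⟩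
    | @insert x F _ _ ihF =>
      intro hx
      obtain ⟨i, hi, hiF⟩ := ihF fun y hy => hx y (Set.mem_insert_of_mem _ hy)
      obtain ⟨j, hj, hjx⟩ := hx x (Set.mem_insert _ _)
      rcases le_total i j with hij | hij
      · exact ⟨j, hj, Set.insert_subset hjx (hiF.trans (hZmono hij))⟩
      · exact ⟨i, hi, Set.insert_subset (hZmono hij hjx) hiF⟩
  -- Continuity at limits follows from finitariness of `U`: a finite subset of `Z i` already lies in
  -- an earlier `Z j`.
  have hlim : ∀ X, ∀ i, Order.IsSuccLimit i → U (X ∩ Z i) ⊆ ⋃ j < i, U (X ∩ Z j) := by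
    intro X i hi a ha
    obtain ⟨F, hF, hFf, haF⟩ := hfin _ a ha
    obtain ⟨j, hj, hjF⟩ := hfinZ (Set.Iio i) (by simpa [not_isMin_iff] using hi.1) F hFf
      fun x hx => by
        obtain ⟨k, hk, rfl⟩ := (hF hx).2
        obtain ⟨j, hj, hji⟩ := (hi.isSuccPrelimit.lt_iff_exists_lt).1 hk
        exact ⟨j, hj, k, hji, rfl⟩
    exact Set.mem_biUnion hj (hmono (Set.subset_inter (hF.trans Set.inter_subset_left) hjF) haF)
  have hunion : ∀ X ⊆ Y, ⋃ i, U (X ∩ Z i) = U X := by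
    intro X hX
    refine Set.Subset.antisymm (Set.iUnion_subset fun i => hmono Set.inter_subset_left) ?_
    intro a ha
    obtain ⟨F, hF, hFf, haF⟩ := hfin _ a ha
    obtain ⟨j, -, hjF⟩ := hfinZ Set.univ Set.univ_nonempty F hFf fun x hx => by
      obtain ⟨k, hk⟩ := exists_gt (e.symm ⟨x, hX (hF hx)⟩)
      exact ⟨k, trivial, _, hk, by simp⟩
    exact Set.mem_iUnion.2 ⟨j, hmono (Set.subset_inter hF hjF) haF⟩
  have hYi : ∀ i, K.IsStrong (U (Y ∩ Z i)) (U Y) := fun i => by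
    have := isStrong_iUnion hK (hchain Y subset_rfl) (hlim Y) i
    rwa [hunion Y subset_rfl] at this
  rw [← hunion X hXY]
  -- Each `U (X ∩ Z i)` is strong in `U (Y ∩ Z i)` by induction, and the latter is strong in `U Y`;
  -- hence so is the union of the former, which is `U X`.
  refine iUnion_isStrong hK (hchain X hXY) (hlim X) fun i => IsStrong.trans hK ?_ (hYi i)
  exact ih _ ((Cardinal.mk_le_mk_of_subset Set.inter_subset_right).trans_lt (hcard i)) _ _
    (Set.inter_subset_inter_left _ hXY) rfl

end StrongClass

open FirstOrder.Language.Substructure (closure)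

/-! ### Generated substructures -/

lemma exists_finite_of_mem_closure {L : FirstOrder.Language.{u, u}} {A : Type u} [L.Structure A]
    (X : Set A) (a : A) (ha : a ∈ closure L X) :
    ∃ F ⊆ X, F.Finite ∧ a ∈ closure L F := by
  refine FirstOrder.Language.Substructure.closure_induction
    (p := fun a => ∃ F ⊆ X, F.Finite ∧ a ∈ closure L F) ha (fun x hx => ?_) fun f x ih => ?_
  · exact ⟨{x}, by simpa using hx, Set.finite_singleton x,
      FirstOrder.Language.Substructure.subset_closure rfl⟩
  · choose F hF hfin hx using ih
    exact ⟨⋃ i, F i, Set.iUnion_subset hF, Set.finite_iUnion hfin,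
      FirstOrder.Language.Substructure.fun_mem _ f x fun i =>
        FirstOrder.Language.Substructure.closure_mono (Set.subset_iUnion F i) (hx i)⟩

lemma coe_closure_range {L : FirstOrder.Language.{u, u}} {A : Type u} [L.Structure A] {α : Type}
    (v : α → A) :
    (closure L (Set.range v) : Set A) = Set.range fun t : L.Term α => t.realize v := by
  ext a
  constructor
  · intro ha
    refine FirstOrder.Language.Substructure.closure_induction
      (p := fun a => ∃ t : L.Term α, t.realize v = a) ha (fun x hx => ?_) fun f x ih => ?_
    · obtain ⟨i, rfl⟩ := hx
      exact ⟨.var i, rfl⟩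
    · choose t ht using ih
      exact ⟨.func f t, congrArg (funMap f) (funext ht)⟩
  · rintro ⟨t, rfl⟩
    exact FirstOrder.Language.Term.realize_mem t v fun i =>
      FirstOrder.Language.Substructure.subset_closure (Set.mem_range_self i)

/-! ### Good structures and omission of types -/

namespace StrongClass

/-- A `τ₁`-structure all of whose finitely generated substructures present structures in `K`, each
being strong in the larger ones. -/
def IsGood (K : StrongClass τ) {τ₁ : FirstOrder.Language.{u, u}} (φ : plusLanguage τ →ᴸ τ₁)
    (A : Type u) [τ₁.Structure A] : Prop :=
  letI := φ.reduct A
  ∀ X Y : Set A, Y.Finite → X ⊆ Y →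
    K.IsStrong (closure τ₁ X : Set A) (closure τ₁ Y : Set A)

variable {K : StrongClass τ} {τ₁ : FirstOrder.Language.{u, u}} {φ : plusLanguage τ →ᴸ τ₁}

section Transfer

variable {A B : Type u} [τ₁.Structure A] [τ₁.Structure B]

/-- Whether the substructures generated by parts of a finite tuple are strong in each other depends
only on the type of the tuple. -/
lemma IsGood.isStrong_of_realize_iff (hB : K.IsGood φ B) [Nonempty B] {n : ℕ} {y : Fin n → A}
    {z : Fin n → B} (h : ∀ ψ : τ₁.Formula (Fin n), ψ.Realize y ↔ ψ.Realize z)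
    (J : Set (Fin n)) :
    letI := φ.reduct A
    K.IsStrong (closure τ₁ (y '' J) : Set A) (closure τ₁ (Set.range y) : Set A) := by
  let _ := φ.reduct A
  let _ := φ.reduct B
  have heq : ∀ t s : τ₁.Term (Fin n), t.realize y = s.realize y ↔ t.realize z = s.realize z :=
    fun t s => by simpa using h (t.equal s)
  -- The map `t(y) ↦ t(z)` on the substructure generated by `y`. It is well defined and injective
  -- because `y` and `z` satisfy the same equations between terms; its default value elsewhere plays
  -- no role.
  let g : A → B := Function.extend (fun t : τ₁.Term (Fin n) => t.realize y)
    (fun t => t.realize z) fun _ => Classical.arbitrary B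
  have hg : ∀ t : τ₁.Term (Fin n), g (t.realize y) = t.realize z := fun t =>
    Function.FactorsThrough.extend_apply (fun t s hts => (heq t s).1 hts) _ t
  have hlift : ∀ J : Set (Fin n), ∀ a ∈ (closure τ₁ (y '' J) : Set A),
      ∃ t : τ₁.Term (Fin n), t.realize y = a := by
    intro J a ha
    have : a ∈ (closure τ₁ (Set.range y) : Set A) :=
      FirstOrder.Language.Substructure.closure_mono (Set.image_subset_range y J) ha
    rwa [coe_closure_range] at this
  have key : ∀ J : Set (Fin n), ∀ {M : CStruct τ} {ι : B → M},
      IsPres (closure τ₁ (z '' J) : Set B) M ι → IsPres (closure τ₁ (y '' J) : Set A) M (ι ∘ g) := by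
    intro J M ι hι
    refine hι.comap g ?_ ?_ ?_ ?_ ?_
    · have hy : y '' J = Set.range (y ∘ ((↑) : J → Fin n)) := by simp [Set.range_comp]
      have hz : z '' J = Set.range (z ∘ ((↑) : J → Fin n)) := by simp [Set.range_comp]
      rw [hy, hz, coe_closure_range, coe_closure_range, ← Set.range_comp]
      congr 1
      funext t
      have := hg (t.relabel (↑))
      rwa [FirstOrder.Language.Term.realize_relabel, FirstOrder.Language.Term.realize_relabel]
        at this
    · intro a ha b hb hab
      obtain ⟨t, rfl⟩ := hlift J a ha
      obtain ⟨s, rfl⟩ := hlift J b hb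
      rw [hg, hg] at hab
      exact (heq t s).2 hab
    · intro m F a ha
      exact FirstOrder.Language.Substructure.fun_mem _ (φ.onFunction F) a ha
    · intro m F a ha
      choose t ht using fun i => hlift J (a i) (ha i)
      obtain rfl : (fun i => (t i).realize y) = a := funext ht
      refine (hg (.func (φ.onFunction F) t)).trans ?_
      exact congrArg (funMap (φ.onFunction F)) (funext fun i => (hg (t i)).symm)
    · intro m R a ha
      choose t ht using fun i => hlift J (a i) (ha i)
      obtain rfl : (fun i => (t i).realize y) = a := funext ht
      have h1 := h ((φ.onRelation R).formula t)
      rw [FirstOrder.Language.Formula.realize_rel, FirstOrder.Language.Formula.realize_rel] at h1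
      have h2 : g ∘ (fun i => (t i).realize y) = fun i => (t i).realize z :=
        funext fun i => hg (t i)
      rw [h2]
      exact h1
  obtain ⟨hs, M, N, ι, κ, f, hι, hκ, hf, hK⟩ :=
    hB (z '' J) (z '' Set.univ) (Set.toFinite _) (Set.image_mono (Set.subset_univ J))
  have hι' := key J hι
  have hκ' := key Set.univ hκ
  rw [← Set.image_univ]
  refine ⟨FirstOrder.Language.Substructure.closure_mono (Set.image_mono (Set.subset_univ J)),
    M, N, _, _, f, hι', hκ', fun a ha => hf (g a) ?_, hK⟩
  have hy : y '' J = Set.range (y ∘ ((↑) : J → Fin n)) := by simp [Set.range_comp]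
  have hz : z '' J = Set.range (z ∘ ((↑) : J → Fin n)) := by simp [Set.range_comp]
  rw [hy, coe_closure_range] at ha
  obtain ⟨t, rfl⟩ := ha
  have := hg (t.relabel (↑))
  rw [FirstOrder.Language.Term.realize_relabel, FirstOrder.Language.Term.realize_relabel] at this
  rw [hz, coe_closure_range]
  exact ⟨t, this.symm⟩

end Transfer

namespace IsGood

variable {A : Type u} [τ₁.Structure A]

lemma isStrong (hK : K.IsMAEC) (hA : K.IsGood φ A) (X Y : Set A) (hXY : X ⊆ Y) :
    letI := φ.reduct A
    K.IsStrong (closure τ₁ X : Set A) (closure τ₁ Y : Set A) := by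
  let _ := φ.reduct A
  have hA' : ∀ X Y : Set A, Y.Finite → X ⊆ Y →
      K.IsStrong (closure τ₁ X : Set A) (closure τ₁ Y : Set A) := hA
  exact isStrong_of_finite hK (U := fun X => (closure τ₁ X : Set A))
    (fun _ _ h => FirstOrder.Language.Substructure.closure_mono h)
    exists_finite_of_mem_closure hA' X Y hXY

/-- Strength of the full substructure in itself already includes a presentation by a member of `K`.
-/
lemma exists_completion (hK : K.IsMAEC) (hA : K.IsGood φ A) :
    ∃ M : CStruct τ, K.Mem M ∧ IsCompletionOfReduct φ A M := by
  let _ := φ.reduct A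
  obtain ⟨M, ι, hι, hM⟩ := (hA.isStrong hK Set.univ Set.univ subset_rfl).exists_pres_left hK
  refine ⟨M, hM, isCompletion_iff.2 ⟨ι, ?_⟩⟩
  simpa using hι

lemma mem (hK : K.IsMAEC) (hA : K.IsGood φ A) {M : CStruct τ}
    (hM : IsCompletionOfReduct φ A M) : K.Mem M := by
  obtain ⟨N, hN, hNA⟩ := hA.exists_completion hK
  let _ := φ.reduct A
  obtain ⟨ι, hι⟩ := isCompletion_iff.1 hM
  obtain ⟨κ, hκ⟩ := isCompletion_iff.1 hNA
  obtain ⟨e, -, he, -⟩ := hκ.exists_iso hι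
  exact hK.mem_iso e he hN

end IsGood

/-- The types over the empty theory that are realized in no good structure. -/
def badTypes (K : StrongClass τ) (φ : plusLanguage τ →ᴸ τ₁) (n : ℕ) :
    Set ((∅ : τ₁.Theory).CompleteType (Fin n)) :=
  {p | ∀ M₁ : (∅ : τ₁.Theory).ModelType.{u, u, u}, K.IsGood φ M₁ →
    p ∉ (∅ : τ₁.Theory).realizedTypes M₁ (Fin n)}

lemma omits_badTypes_iff (M₁ : (∅ : τ₁.Theory).ModelType.{u, u, u}) :
    Omits ∅ (K.badTypes φ) M₁ ↔ K.IsGood φ M₁ := by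
  constructor
  · intro h X Y hY hXY
    obtain ⟨n, y, rfl⟩ : ∃ (n : ℕ) (y : Fin n → M₁), Set.range y = Y := by
      obtain ⟨n, f, hf⟩ := hY.fin_embedding
      exact ⟨n, f, hf⟩
    -- A type realized here is not in `Γ`, so some good structure realizes it too, and goodness at
    -- that realization transfers back to `y`.
    have hp : (∅ : τ₁.Theory).typeOf y ∉ K.badTypes φ n := fun hbad => h n _ hbad ⟨y, rfl⟩
    obtain ⟨M', hM', z, hz⟩ : ∃ M' : (∅ : τ₁.Theory).ModelType.{u, u, u}, K.IsGood φ M' ∧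
        ∃ z : Fin n → M', (∅ : τ₁.Theory).typeOf z = (∅ : τ₁.Theory).typeOf y := by
      by_contra hcon
      refine hp fun M' hM' hr => hcon ⟨M', hM', ?_⟩
      exact hr
    have hX : X = y '' (y ⁻¹' X) := (Set.image_preimage_eq_of_subset hXY).symm
    rw [hX]
    refine hM'.isStrong_of_realize_iff (y := y) (z := z) (fun ψ => ?_) _
    rw [← FirstOrder.Language.Theory.CompleteType.formula_mem_typeOf (T := ∅), ← hz,
      FirstOrder.Language.Theory.CompleteType.formula_mem_typeOf]
  · exact fun h n p hp hr => hp M₁ h hr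

end StrongClass

/-! ### Strong subsets of a structure in the class -/

/-- A continuous structure, viewed as a `τ⁺`-structure. -/
@[reducible] def CStruct.plusStructure (M : CStruct τ) : (plusLanguage τ).Structure M where
  funMap := fun F x => M.fn F x
  RelMap := fun R x => match R with
    | .ge P r => r.toReal ≤ M.pred P x
    | .le P r => M.pred P x ≤ r.toReal

namespace CStruct

attribute [local instance] plusStructure

lemma isPres_univ (M : CStruct τ) : IsPres Set.univ M (fun x : M => x) :=
  ⟨Set.injOn_id _, by simp, fun _ _ _ => trivial, fun _ _ _ => rfl,
    fun _ _ _ _ => Iff.rfl, fun _ _ _ _ => Iff.rfl⟩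

/-- `f` identifies `N` with `closure S`, in which `S` is dense; on `S` the presentation is the
inverse of `f`. -/
lemma isPres_of_closure_eq {M N : CStruct τ} (f : CEmb N M) {S : Set M}
    (hS : ∀ {n : ℕ} (F : τ.Functions n) (a : Fin n → M), (∀ i, a i ∈ S) → M.fn F a ∈ S)
    (hf : closure S = Set.range f) : IsPres S N (Function.invFun f) := by
  have hsub : S ⊆ Set.range f := hf ▸ subset_closure
  have hinv : ∀ a ∈ S, f (Function.invFun f a) = a := fun a ha => Function.invFun_eq (hsub ha)
  have hcomp : ∀ {n : ℕ} (a : Fin n → M), (∀ i, a i ∈ S) → f ∘ Function.invFun f ∘ a = a :=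
    fun a ha => funext fun i => hinv _ (ha i)
  refine ⟨fun a ha b hb hab => ?_, ?_, hS, fun F a ha => ?_, fun P r a ha => ?_,
    fun P r a ha => ?_⟩
  · rw [← hinv a ha, ← hinv b hb, hab]
  · intro x
    rw [f.isometry.isUniformInducing.isInducing.closure_eq_preimage_closure_image,
      ← Set.image_comp]
    have : (fun a => (f ∘ Function.invFun f) a) '' S = S := by
      conv_rhs => rw [← Set.image_id S]
      exact Set.image_congr hinv
    rw [this, Set.mem_preimage, hf]
    exact ⟨x, rfl⟩
  · apply f.isometry.injective
    rw [f.map_fn, hcomp a ha]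
    exact hinv _ (hS F a ha)
  · rw [← f.map_pred, hcomp a ha]; rfl
  · rw [← f.map_pred, hcomp a ha]; rfl

end CStruct

namespace StrongClass

attribute [local instance] CStruct.plusStructure

variable {K : StrongClass τ} {M : CStruct τ}

/-- Being strong in `M` depends only on the closure of `S`. In the forward direction, `f` is an
isometry from a complete space, so its range is closed and equals that closure. -/
lemma isStrong_univ_iff (hK : K.IsMAEC) {S : Set M}
    (hS : ∀ {n : ℕ} (F : τ.Functions n) (a : Fin n → M), (∀ i, a i ∈ S) → M.fn F a ∈ S) :
    K.IsStrong S Set.univ ↔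
      ∃ (N : CStruct τ) (f : CEmb N M), K.Strong f ∧ closure S = Set.range f := by
  constructor
  · intro h
    obtain ⟨N, ι, hι, -⟩ := h.exists_pres_left hK
    obtain ⟨f, hf⟩ := hι.exists_cemb M.isPres_univ (Set.subset_univ S)
    refine ⟨N, f, h.strong hK hι M.isPres_univ f hf, Set.Subset.antisymm ?_ ?_⟩
    · exact closure_minimal (fun a ha => ⟨ι a, hf a ha⟩)
        f.isometry.isClosedEmbedding.isClosed_range
    · rintro _ ⟨x, rfl⟩
      refine closure_mono ?_ (image_closure_subset_closure_image f.isometry.continuous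
        ⟨x, hι.dense x, rfl⟩)
      rintro _ ⟨_, ⟨a, ha, rfl⟩, rfl⟩
      rwa [hf a ha]
  · rintro ⟨N, f, hf, hSf⟩
    refine ⟨Set.subset_univ S, N, M, _, _, f, CStruct.isPres_of_closure_eq f hS hSf, M.isPres_univ,
      fun a ha => Function.invFun_eq ?_, hf⟩
    have : a ∈ Set.range f := hSf ▸ subset_closure ha
    exact this

lemma fn_mem_range {M N : CStruct τ} (f : CEmb N M) {n : ℕ} (F : τ.Functions n) (a : Fin n → M)
    (ha : ∀ i, a i ∈ Set.range f) : M.fn F a ∈ Set.range f := by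
  choose x hx using ha
  obtain rfl : f ∘ x = a := funext hx
  exact ⟨_, f.map_fn F x⟩

/-- If `E` is a monotone family of sets, indexed by the finite subsets of `M`, whose closures are
strong in `M`, then every subset of `M` that is closed under `E` and the functions has a strong
closure. -/
lemma isStrong_univ_of_finset (hK : K.IsMAEC) {E : Finset M → Set M} (hE : Monotone E)
    (hsub : ∀ c : Finset M, (c : Set M) ⊆ E c)
    (hstrong : ∀ c, ∃ (N : CStruct τ) (f : CEmb N M), K.Strong f ∧ closure (E c) = Set.range f)
    {S : Set M}
    (hS : ∀ {n : ℕ} (F : τ.Functions n) (a : Fin n → M), (∀ i, a i ∈ S) → M.fn F a ∈ S)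
    (hES : ∀ c : Finset M, (c : Set M) ⊆ S → E c ⊆ S) : K.IsStrong S Set.univ := by
  -- The sets `E c` need not be closed under the functions of `M`, but their closures are, being
  -- ranges of embeddings.
  let U : Set M → Set M := fun X => ⋃ c : {c : Finset M // (c : Set M) ⊆ X}, closure (E c)
  have hUmono : Monotone U := fun X Y hXY =>
    Set.iUnion_subset fun c => Set.subset_iUnion (fun c : {c : Finset M // (c : Set M) ⊆ Y} =>
      closure (E c)) ⟨c, c.2.trans hXY⟩
  have hUfin : ∀ X, ∀ a ∈ U X, ∃ F ⊆ X, F.Finite ∧ a ∈ U F := fun X a ha => by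
    obtain ⟨c, hc⟩ := Set.mem_iUnion.1 ha
    exact ⟨c, c.2, c.1.finite_toSet, Set.mem_iUnion.2 ⟨⟨c, subset_rfl⟩, hc⟩⟩
  have hclosure : ∀ c, K.IsStrong (closure (E c)) Set.univ := fun c => by
    obtain ⟨N, f, hf, hr⟩ := hstrong c
    refine (isStrong_univ_iff hK fun F a ha => ?_).2 ⟨N, f, hf, by rwa [closure_closure]⟩
    rw [hr] at ha ⊢
    exact fn_mem_range f F a ha
  have hU : ∀ X : Set M, X.Finite → K.IsStrong (U X) Set.univ := fun X hX => by
    have : U X = closure (E hX.toFinset) := by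
      refine Set.Subset.antisymm (Set.iUnion_subset fun c => closure_mono (hE ?_)) ?_
      · intro x hx
        exact hX.mem_toFinset.2 (c.2 hx)
      · exact Set.subset_iUnion (fun c : {c : Finset M // (c : Set M) ⊆ X} =>
          closure (E c)) ⟨hX.toFinset, by simp⟩
    rw [this]
    exact hclosure _
  have hSU : S ⊆ U S := fun a ha =>
    Set.mem_iUnion.2 ⟨⟨{a}, by simpa using ha⟩, subset_closure (hsub {a} (by simp))⟩
  have hUS : U S ⊆ closure S := Set.iUnion_subset fun c => closure_mono (hES c c.2)
  have hUuniv : U Set.univ = Set.univ := Set.eq_univ_of_forall fun a =>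
    Set.mem_iUnion.2 ⟨⟨{a}, Set.subset_univ _⟩, subset_closure (hsub {a} (by simp))⟩
  have hstr : K.IsStrong (U S) Set.univ := by
    -- On finite sets both values of `U` are strong in `M`, so coherence compares them.
    have := isStrong_of_finite hK hUmono hUfin (fun X Y hY hXY =>
      (hU X (hY.subset hXY)).coherence hK (hUmono hXY) (hU Y hY)) S Set.univ (Set.subset_univ S)
    rwa [hUuniv] at this
  obtain ⟨N, f, hf, hr⟩ := (isStrong_univ_iff hK fun F a ha => by
    obtain ⟨N, ι, hι, -⟩ := hstr.exists_pres_left hK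
    exact hι.fn_mem F a ha).1 hstr
  refine (isStrong_univ_iff hK hS).2 ⟨N, f, hf, ?_⟩
  rw [← hr]
  exact Set.Subset.antisymm (closure_mono hSU) (closure_minimal hUS isClosed_closure)

/-! ### Löwenheim–Skolem hulls -/

lemma isLSCardinal_LS (hK : K.IsMAEC) : K.IsLSCardinal K.LS :=
  csInf_mem (s := {μ | K.IsLSCardinal μ}) hK.exists_LS

lemma exists_dense_card (X : Type u) [TopologicalSpace X] :
    ∃ D : Set X, Dense D ∧ #D = densityCharacter X :=
  csInf_mem (s := {κ : Cardinal.{u} | ∃ D : Set X, Dense D ∧ #D = κ})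
    ⟨_, Set.univ, dense_univ, rfl⟩

/-- `E` is a least-size dense subset of a Löwenheim–Skolem submodel together with `A` itself, which
the dense set may miss. The cardinality bound is conditional so that the hull is an operator on all
subsets. -/
lemma exists_hull (hK : K.IsMAEC) (hM : K.Mem M) (A : Set M) :
    ∃ E : Set M, A ⊆ E ∧ (#A ≤ K.LS → #E ≤ K.LS) ∧
      ∃ (N : CStruct τ) (f : CEmb N M), K.Strong f ∧ closure E = Set.range f := by
  obtain ⟨hinf, -, hLS⟩ := isLSCardinal_LS hK
  obtain ⟨N, f, hf, hA, hN⟩ := hLS M hM A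
  obtain ⟨D, hD, hDc⟩ := exists_dense_card N
  refine ⟨f '' D ∪ A, Set.subset_union_right, fun hAc => ?_, N, f, hf, ?_⟩
  · refine (Cardinal.mk_union_le _ _).trans (Cardinal.add_le_of_le hinf ?_ hAc)
    refine Cardinal.mk_image_le.trans (hDc.le.trans (hN.trans ?_))
    exact Cardinal.add_le_of_le hinf hAc le_rfl
  · refine Set.Subset.antisymm (closure_minimal (Set.union_subset (Set.image_subset_range f D) hA)
      f.isometry.isClosedEmbedding.isClosed_range) ?_
    rintro _ ⟨x, rfl⟩
    exact closure_mono Set.subset_union_left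
      (image_closure_subset_closure_image f.isometry.continuous ⟨x, hD x, rfl⟩)

/-- The monotone family of hulls of finite sets generated by a hull operator. -/
noncomputable def finsetHull {X : Type u} (h : Set X → Set X) : Finset X → Set X :=
  Finset.strongInduction fun c ih => h ((c : Set X) ∪ ⋃ b : {b : Finset X // b ⊂ c}, ih b.val b.property)

lemma finsetHull_eq {X : Type u} (h : Set X → Set X) (c : Finset X) :
    finsetHull h c = h (c ∪ ⋃ b : {b : Finset X // b ⊂ c}, finsetHull h b) := by
  rw [finsetHull, Finset.strongInduction_eq]

lemma coe_subset_finsetHull {X : Type u} {h : Set X → Set X} (hh : ∀ A, A ⊆ h A) (c : Finset X) :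
    (c : Set X) ⊆ finsetHull h c := by
  rw [finsetHull_eq]
  exact Set.subset_union_left.trans (hh _)

/-- The hulls of all proper subsets of `c` are included in the set whose hull is taken at `c`. -/
lemma monotone_finsetHull {X : Type u} {h : Set X → Set X} (hh : ∀ A, A ⊆ h A) :
    Monotone (finsetHull h) := by
  intro b c hbc
  rcases eq_or_ssubset_of_subset hbc with rfl | hlt
  · exact le_rfl
  · rw [finsetHull_eq h c]
    exact ((Set.subset_iUnion (fun b : {b : Finset X // b ⊂ c} => finsetHull h b) ⟨b, hlt⟩).trans
      Set.subset_union_right).trans (hh _)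

lemma mk_finsetHull_le {X : Type u} {h : Set X → Set X} {μ : Cardinal.{u}} (hμ : ℵ₀ ≤ μ)
    (hh : ∀ A : Set X, #A ≤ μ → #(h A) ≤ μ) (c : Finset X) : #(finsetHull h c) ≤ μ := by
  induction c using Finset.strongInduction with
  | H c ih =>
  rw [finsetHull_eq]
  have hfin : Finite {b : Finset X // b ⊂ c} :=
    Set.Finite.to_subtype (s := {b | b ⊂ c})
      ((Finset.finite_toSet c.powerset).subset fun b hb => by simpa using hb.1)
  refine hh _ ((Cardinal.mk_union_le _ _).trans (Cardinal.add_le_of_le hμ ?_ ?_))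
  · exact (Cardinal.mk_le_aleph0_iff.2 c.finite_toSet.countable.to_subtype).trans hμ
  · refine (Cardinal.mk_iUnion_le_sum_mk).trans
      ((Cardinal.sum_le_sum _ (fun _ => μ)
        fun b : {b : Finset X // b ⊂ c} => ih b.1 b.2).trans ?_)
    rw [Cardinal.sum_const, Cardinal.lift_id, Cardinal.lift_id]
    exact Cardinal.mul_le_of_le hμ ((Cardinal.mk_le_aleph0_iff.2 inferInstance).trans hμ) le_rfl

end StrongClass

/-! ### The expanded language -/

/-- The language with `μ` function symbols of each arity. -/
def functionLanguage (μ : Cardinal.{u}) : FirstOrder.Language.{u, u} where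
  Functions := fun _ => μ.out
  Relations := fun _ => PEmpty

lemma card_functionLanguage {μ : Cardinal.{u}} (hμ : ℵ₀ ≤ μ) : (functionLanguage μ).card = μ := by
  rw [FirstOrder.Language.card_eq_card_functions_add_card_relations]
  simp [functionLanguage, Cardinal.aleph0_mul_eq hμ]

lemma card_plusLanguage_le {μ : Cardinal.{u}} (hμ : ℵ₀ ≤ μ) (hτ : τ.card ≤ μ) :
    (plusLanguage τ).card ≤ μ := by
  have : Countable UnitRat := inferInstanceAs (Countable {q : ℚ // 0 ≤ q ∧ q ≤ 1})
  -- `none` codes the metric. The arity can be dropped, as the symbol determines it.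
  let code : (Σ n, PlusRel τ n) → Option (Σ n, τ.Relations n) × UnitRat × Bool := fun R =>
    match R with
    | ⟨_, .ge .dist r⟩ => (none, r, true)
    | ⟨_, .ge (.rel R) r⟩ => (some ⟨_, R⟩, r, true)
    | ⟨_, .le .dist r⟩ => (none, r, false)
    | ⟨_, .le (.rel R) r⟩ => (some ⟨_, R⟩, r, false)
  have hcode : Function.Injective code := by
    rintro ⟨n, P | P⟩ ⟨m, Q | Q⟩ h <;> rcases P with _ | P <;> rcases Q with _ | Q <;>
      simp only [code, Prod.mk.injEq, Option.some.injEq, Sigma.mk.injEq, reduceCtorEq, and_false,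
        false_and, true_and, and_true] at h
    all_goals
      first
      | (obtain ⟨⟨rfl, h1⟩, rfl⟩ := h
         obtain rfl := eq_of_heq h1
         rfl)
      | (subst h
         rfl)
  have hF : #(Σ n, τ.Functions n) ≤ μ :=
    (Cardinal.mk_le_of_injective (β := τ.Symbols) Sum.inl_injective).trans hτ
  have hR : #(Σ n, τ.Relations n) ≤ μ :=
    (Cardinal.mk_le_of_injective (β := τ.Symbols) Sum.inr_injective).trans hτ
  have hRel : #(Σ n, PlusRel τ n) ≤ μ := by
    refine (Cardinal.mk_le_of_injective (β := Option (Σ n, τ.Relations n) × ULift (UnitRat × Bool))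
      (f := fun R => ((code R).1, ⟨(code R).2⟩)) fun R S h => hcode ?_).trans ?_
    · simp only [Prod.mk.injEq, ULift.up.injEq] at h
      exact Prod.ext h.1 h.2
    · rw [Cardinal.mk_prod, Cardinal.lift_id, Cardinal.lift_id]
      refine Cardinal.mul_le_of_le hμ ?_ ((Cardinal.mk_le_aleph0_iff.2 inferInstance).trans hμ)
      rw [Cardinal.mk_option]
      exact Cardinal.add_le_of_le hμ hR (Cardinal.one_le_aleph0.trans hμ)
  change #((Σ n, τ.Functions n) ⊕ (Σ n, PlusRel τ n)) ≤ μ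
  rw [Cardinal.mk_sum, Cardinal.lift_id, Cardinal.lift_id]
  exact Cardinal.add_le_of_le hμ hF hRel

/-! ### Expanding a member of the class to a good structure -/

namespace StrongClass

variable {K : StrongClass τ}

/-- The discrete structure lives on all of `M`, so `M` is trivially its completion; the new
functions only have to make every substructure closed under the finite hulls. -/
lemma exists_good_expansion (hK : K.IsMAEC) {M : CStruct τ} (hM : K.Mem M) :
    ∃ M₁ : (∅ : ((plusLanguage τ).sum (functionLanguage K.LS)).Theory).ModelType.{u, u, u},
      K.IsGood (τ₁ := (plusLanguage τ).sum (functionLanguage K.LS))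
        FirstOrder.Language.LHom.sumInl M₁ ∧
      IsCompletionOfReduct (τ₁ := (plusLanguage τ).sum (functionLanguage K.LS))
        FirstOrder.Language.LHom.sumInl M₁ M := by
  classical
  choose h hsub hcard hstrong using fun A : Set M => exists_hull hK hM A
  -- This includes `c = ∅`: the constants enumerate its hull, so even the empty set generates a
  -- nonempty substructure.
  have hne : ∀ c : Finset M, Nonempty (finsetHull h c) := fun c => by
    rw [finsetHull_eq]
    obtain ⟨N, f, -, hf⟩ := hstrong (c ∪ ⋃ b : {b : Finset M // b ⊂ c}, finsetHull h b)
    refine (closure_nonempty_iff.1 ?_).to_subtype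
    rw [hf]
    exact Set.range_nonempty f
  have hle : ∀ c : Finset M, #(finsetHull h c) ≤ #K.LS.out := fun c => by
    rw [Cardinal.mk_out]
    exact mk_finsetHull_le (isLSCardinal_LS hK).1 hcard c
  have henum : ∀ c : Finset M, ∃ e : K.LS.out → M, Set.range e = finsetHull h c := fun c => by
    obtain ⟨e⟩ := Cardinal.le_def _ _ |>.1 (hle c)
    have := hne c
    refine ⟨fun i => (Function.invFun e i : finsetHull h c), ?_⟩
    rw [Set.range_comp' Subtype.val, (Function.invFun_surjective e.injective).range_eq]
    simp
  choose e he using henum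
  let _ : (functionLanguage K.LS).Structure M :=
    -- The value depends only on the set of entries; a finite set `c` is reached through the symbols
    -- of arity `c.card`.
    { funMap := fun i x => e (Finset.univ.image x) i
      RelMap := fun R => R.elim }
  let _ : (plusLanguage τ).Structure M := M.plusStructure
  refine ⟨FirstOrder.Language.Theory.ModelType.of ∅ M, ?_, isCompletion_iff.2 ⟨_, M.isPres_univ⟩⟩
  have key : ∀ X : Set M, K.IsStrong (FirstOrder.Language.Substructure.closure
      ((plusLanguage τ).sum (functionLanguage K.LS)) X : Set M) Set.univ := fun X => by
    refine isStrong_univ_of_finset hK (monotone_finsetHull hsub) (coe_subset_finsetHull hsub)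
      (fun c => ?_) (fun F a ha => ?_) (fun c hc => ?_)
    · rw [finsetHull_eq]
      exact hstrong _
    · exact FirstOrder.Language.Substructure.fun_mem _
        (Sum.inl F : ((plusLanguage τ).sum (functionLanguage K.LS)).Functions _) a ha
    · rw [← he]
      rintro _ ⟨i, rfl⟩
      have := FirstOrder.Language.Substructure.fun_mem (FirstOrder.Language.Substructure.closure
        ((plusLanguage τ).sum (functionLanguage K.LS)) X)
        (Sum.inr i : ((plusLanguage τ).sum (functionLanguage K.LS)).Functions c.card)
        (fun k => (c.equivFin.symm k : M)) fun k => hc (c.equivFin.symm k).2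
      have himg : Finset.univ.image (fun k => (c.equivFin.symm k : M)) = c := by
        ext x
        simp only [Finset.mem_image, Finset.mem_univ, true_and]
        exact ⟨by rintro ⟨k, rfl⟩; exact (c.equivFin.symm k).2,
          fun hx => ⟨c.equivFin ⟨x, hx⟩, by simp⟩⟩
      have h2 : e (Finset.univ.image (fun k => (c.equivFin.symm k : M))) i ∈
        FirstOrder.Language.Substructure.closure
          ((plusLanguage τ).sum (functionLanguage K.LS)) X := this
      rwa [himg] at h2
  intro X Y _ hXY
  exact (key X).coherence hK (FirstOrder.Language.Substructure.closure_mono hXY) (key Y)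

end StrongClass

end MetricAEC

theorem mainTheorem4 (τ : FirstOrder.Language.{u, u}) (K : MetricAEC.StrongClass τ)
    (hK : K.IsMAEC) :
    ∃ (τ₁ : FirstOrder.Language.{u, u}) (φ : MetricAEC.plusLanguage τ →ᴸ τ₁)
      (T₁ : τ₁.Theory) (Γ : ∀ n : ℕ, Set (T₁.CompleteType (Fin n))),
      φ.Injective ∧ τ₁.card = K.LS ∧
      (∀ M : MetricAEC.CStruct τ,
        K.Mem M ↔ ∃ M₁ : T₁.ModelType.{u, u, u},
          MetricAEC.Omits T₁ Γ M₁ ∧ MetricAEC.IsCompletionOfReduct φ M₁ M) ∧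
      (∀ M₁ : T₁.ModelType.{u, u, u}, MetricAEC.Omits T₁ Γ M₁ →
        ∃ M : MetricAEC.CStruct τ, MetricAEC.IsCompletionOfReduct φ M₁ M) := by
  obtain ⟨hinf, hτ, -⟩ := MetricAEC.StrongClass.isLSCardinal_LS hK
  refine ⟨(MetricAEC.plusLanguage τ).sum (MetricAEC.functionLanguage K.LS),
    FirstOrder.Language.LHom.sumInl, ∅, K.badTypes FirstOrder.Language.LHom.sumInl,
    FirstOrder.Language.LHom.sumInl_injective, ?_, fun M => ⟨fun hM => ?_, ?_⟩, fun M₁ h => ?_⟩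
  · rw [FirstOrder.Language.card_sum, Cardinal.lift_id, Cardinal.lift_id,
      MetricAEC.card_functionLanguage hinf]
    -- The new symbols number exactly `LS(K)`, which absorbs the at most `LS(K)` symbols of `τ⁺`.
    exact Cardinal.add_eq_right hinf (MetricAEC.card_plusLanguage_le hinf hτ)
  · obtain ⟨M₁, hgood, hM₁⟩ := MetricAEC.StrongClass.exists_good_expansion hK hM
    exact ⟨M₁, (MetricAEC.StrongClass.omits_badTypes_iff M₁).2 hgood, hM₁⟩
  · rintro ⟨M₁, h, hM₁⟩
    exact ((MetricAEC.StrongClass.omits_badTypes_iff M₁).1 h).mem hK hM₁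
  · obtain ⟨M, -, hM⟩ := ((MetricAEC.StrongClass.omits_badTypes_iff M₁).1 h).exists_completion hK
    exact ⟨M, hM⟩
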